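/- Let $X$ be a countably infinite set and let $b\colon X\times X\to[0,\infty)$ be symmetric, zero on the diagonal, with $\deg(x):=\sum_{y\in X}b(x,y)<\infty$ for all $x\in X$. For $f\colon X\to\mathbb C$ put $\tilde Q(f)=\frac12\sum_{x,y\in X}b(x,y)|f(x)-f(y)|^2\in[0,\infty]$. Let $C_c(X)$ be the space of finitely supported functions, and for $o\in X$ let $\tilde D_0$ be the closure of $C_c(X)$ in $\{f:\tilde Q(f)<\infty\}$ with respect to the norm $(\tilde Q(f)+|f(o)|^2)^{1/2}$ (if the graph is connected, this does not depend on $o$). Assume that $(b,0)$ is uniformly transient, i.e. the graph with edges $\{x,y\}$, $b(x,y)>0$, is connected and there is $C>0$ with $\|f\|_\infty^2\le C\,\tilde Q(f)$ for all $f\in\tilde D_0$. Assume also that $\deg$ is bounded on $X$. For a finite measure $m$ on $X$ with $m(\{x\})>0$ for all $x\in X$, let $Q^{(D)}$ be the closure in $\ell^2(X,m)$ of the restriction of $\tilde Q$ to $C_c(X)$, and let the Dirichlet Laplacian $L^{(D)}$ be its generator: the positive self-adjoint operator such that $f\in D(L^{(D)})$ and $L^{(D)}f=g$ if and only if $f\in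 D(Q^{(D)})$, $g\in\ell^2(X,m)$ and $Q^{(D)}(h,f)=\langle h,g\rangle$ for all $h\in D(Q^{(D)})$. Then for every $\varepsilon>0$ there is a finite measure $m$ on $X$, with $m(\{x\})>0$ for all $x\in X$, such that $L^{(D)}$ has purely discrete spectrum, that is, $\ell^2(X,m)$ has an orthonormal basis of eigenvectors of $L^{(D)}$ whose eigenvalues $\lambda_1\le\lambda_2\le\cdots$, counted with multiplicity, tend to infinity, and these eigenvalues satisfy $$\frac{\lambda_k}{k^{1+\varepsilon}}\longrightarrow 0\qquad(k\to\infty).$$ -/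

import Mathlib

open MeasureTheory Filter Topology
open scoped ENNReal NNReal InnerProductSpace ComplexConjugate

noncomputable section

/-- A graph `(b, 0)` over `X` (no killing term): symmetric edge weights `b : X × X → [0, ∞)`,
vanishing on the diagonal, with `∑ y, b x y < ∞` for every `x`. -/
structure WeightedGraph (X : Type*) where
  b : X → X → ℝ≥0
  symm : ∀ x y, b x y = b y x
  diag : ∀ x, b x x = 0
  summable : ∀ x, Summable (b x)

namespace WeightedGraph

variable {X : Type*} (G : WeightedGraph X)

/-- The combinatorial graph of `(b, 0)`: `x ∼ y` if and only if `b x y > 0`. -/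
def toSimpleGraph : SimpleGraph X where
  Adj x y := 0 < G.b x y
  symm := ⟨fun x y h => by rw [G.symm y x]; exact h⟩
  loopless := ⟨fun x h => by rw [G.diag x] at h; exact lt_irrefl _ h⟩

/-- The weighted vertex degree `deg x = ∑ y, b x y`. -/
def deg (x : X) : ℝ≥0 := ∑' y, G.b x y

/-- The energy `Q̃ f = (1/2) ∑ x y, b x y |f x - f y|²`, with values in `[0, ∞]`, of an arbitrary
function `f : X → ℂ`. -/
def energy (f : X → ℂ) : ℝ≥0∞ :=
  2⁻¹ * ∑' p : X × X, (G.b p.1 p.2 : ℝ≥0∞) * ‖f p.1 - f p.2‖ₑ ^ 2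

/-- The space `D̃₀`: the closure of the finitely supported functions in the space of functions of
finite energy with respect to the norm `‖f‖_o = (Q̃ f + |f o|²) ^ (1/2)`. For connected graphs
it does not depend on the vertex `o`. -/
def energyClosure (o : X) : Set (X → ℂ) :=
  {f | G.energy f < ∞ ∧ ∀ ε : ℝ≥0∞, 0 < ε →
    ∃ g : X → ℂ, g.support.Finite ∧ G.energy (f - g) + ‖f o - g o‖ₑ ^ 2 < ε}

/-- Uniform transience (over a countably infinite set `X`): the graph is connected and
`‖f‖_∞² ≤ C Q̃ f` for all `f` in `D̃₀`. -/
def IsUniformlyTransient : Prop :=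
  G.toSimpleGraph.Connected ∧
    ∃ C : ℝ≥0, 0 < C ∧ ∀ o : X, ∀ f ∈ G.energyClosure o,
      (⨆ x, ‖f x‖ₑ) ^ 2 ≤ (C : ℝ≥0∞) * G.energy f

/-- The sesquilinear form obtained from the energy by polarization (conjugate linear in the first
argument); the sum converges absolutely for functions of finite energy. -/
def energyForm (f g : X → ℂ) : ℂ :=
  2⁻¹ * ∑' p : X × X, ((G.b p.1 p.2 : ℝ) : ℂ) * (conj (f p.1 - f p.2) * (g p.1 - g p.2))

/-! ### Elementary facts about the energy -/

theorem energy_zero : G.energy 0 = 0 := by simp [energy]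

theorem energy_smul (c : ℂ) (f : X → ℂ) : G.energy (c • f) = ‖c‖ₑ ^ 2 * G.energy f := by
  have h : ∀ p : X × X, (G.b p.1 p.2 : ℝ≥0∞) * ‖(c • f) p.1 - (c • f) p.2‖ₑ ^ 2
      = ‖c‖ₑ ^ 2 * ((G.b p.1 p.2 : ℝ≥0∞) * ‖f p.1 - f p.2‖ₑ ^ 2) := by
    intro p
    rw [Pi.smul_apply, Pi.smul_apply, ← smul_sub, enorm_smul]
    ring
  simp only [energy, h, ENNReal.tsum_mul_left]
  ring

theorem enorm_add_sq_le (z w : ℂ) : ‖z + w‖ₑ ^ 2 ≤ 2 * (‖z‖ₑ ^ 2 + ‖w‖ₑ ^ 2) := by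
  have h : ‖z + w‖₊ ^ 2 ≤ 2 * (‖z‖₊ ^ 2 + ‖w‖₊ ^ 2) := by
    rw [← NNReal.coe_le_coe]
    push_cast
    nlinarith [norm_add_le z w, norm_nonneg (z + w), sq_nonneg (‖z‖ - ‖w‖)]
  simp only [enorm_eq_nnnorm]
  exact_mod_cast h

theorem energy_add_le (f g : X → ℂ) :
    G.energy (f + g) ≤ 2 * (G.energy f + G.energy g) := by
  have h : ∀ p : X × X, (G.b p.1 p.2 : ℝ≥0∞) * ‖(f + g) p.1 - (f + g) p.2‖ₑ ^ 2
      ≤ 2 * ((G.b p.1 p.2 : ℝ≥0∞) * ‖f p.1 - f p.2‖ₑ ^ 2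
        + (G.b p.1 p.2 : ℝ≥0∞) * ‖g p.1 - g p.2‖ₑ ^ 2) := by
    intro p
    have e : (f + g) p.1 - (f + g) p.2 = (f p.1 - f p.2) + (g p.1 - g p.2) := by
      simp only [Pi.add_apply]; ring
    rw [e]
    calc _ ≤ (G.b p.1 p.2 : ℝ≥0∞) * (2 * (‖f p.1 - f p.2‖ₑ ^ 2 + ‖g p.1 - g p.2‖ₑ ^ 2)) := by
          gcongr
          exact enorm_add_sq_le _ _
      _ = _ := by ring
  have e := ENNReal.tsum_le_tsum h
  rw [ENNReal.tsum_mul_left, ENNReal.tsum_add] at e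
  calc G.energy (f + g) ≤ 2⁻¹ * _ := mul_le_mul_right e _
    _ = _ := by
        unfold energy
        ring

theorem summable_of_energy_lt_top {f : X → ℂ} (hf : G.energy f < ∞) :
    Summable fun p : X × X => (G.b p.1 p.2 : ℝ) * ‖f p.1 - f p.2‖ ^ 2 := by
  have h1 : (∑' p : X × X, (G.b p.1 p.2 : ℝ≥0∞) * ‖f p.1 - f p.2‖ₑ ^ 2) ≠ ∞ := by
    intro h
    rw [energy, h] at hf
    simp at hf
  have h2 : ∀ p : X × X, (G.b p.1 p.2 : ℝ≥0∞) * ‖f p.1 - f p.2‖ₑ ^ 2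
      = ((G.b p.1 p.2 * ‖f p.1 - f p.2‖₊ ^ 2 : ℝ≥0) : ℝ≥0∞) := by
    intro p
    simp [enorm_eq_nnnorm]
  simp only [h2] at h1
  have h3 := NNReal.summable_coe.2 (ENNReal.tsum_coe_ne_top_iff_summable.1 h1)
  simpa using h3

theorem summable_energyForm {f g : X → ℂ} (hf : G.energy f < ∞) (hg : G.energy g < ∞) :
    Summable fun p : X × X =>
      ((G.b p.1 p.2 : ℝ) : ℂ) * (conj (f p.1 - f p.2) * (g p.1 - g p.2)) := by
  refine Summable.of_norm_bounded
    ((G.summable_of_energy_lt_top hf).add (G.summable_of_energy_lt_top hg)) fun p => ?_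
  rw [norm_mul, norm_mul, RCLike.norm_conj, Complex.norm_real, ← mul_add,
    Real.norm_of_nonneg (NNReal.coe_nonneg _)]
  refine mul_le_mul_of_nonneg_left ?_ (G.b p.1 p.2).2
  nlinarith [sq_nonneg (‖f p.1 - f p.2‖ - ‖g p.1 - g p.2‖),
    norm_nonneg (f p.1 - f p.2), norm_nonneg (g p.1 - g p.2),
    sq_nonneg (‖f p.1 - f p.2‖ + ‖g p.1 - g p.2‖)]

theorem energyForm_add_right {f g h : X → ℂ} (hf : G.energy f < ∞) (hg : G.energy g < ∞)
    (hh : G.energy h < ∞) :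
    G.energyForm h (f + g) = G.energyForm h f + G.energyForm h g := by
  unfold energyForm
  rw [← mul_add, ← (G.summable_energyForm hh hf).tsum_add (G.summable_energyForm hh hg)]
  congr 2
  ext p
  simp only [Pi.add_apply]
  ring

theorem energyForm_smul_right (c : ℂ) (f h : X → ℂ) :
    G.energyForm h (c • f) = c * G.energyForm h f := by
  unfold energyForm
  rw [mul_left_comm, ← tsum_mul_left (a := c)]
  refine congrArg (fun z : ℂ => 2⁻¹ * z) (tsum_congr fun p => ?_)
  simp only [Pi.smul_apply, smul_eq_mul]
  ring

theorem energy_indicator_lt_top (o : X) :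
    G.energy (Set.indicator {o} fun _ => (1 : ℂ)) < ∞ := by
  classical
  have hdeg : ∀ x, (∑' y, (G.b x y : ℝ≥0∞)) ≠ ∞ := fun x =>
    ENNReal.tsum_coe_ne_top_iff_summable.2 (G.summable x)
  have h : ∀ p : X × X, (G.b p.1 p.2 : ℝ≥0∞) * ‖Set.indicator {o} (fun _ => (1 : ℂ)) p.1
        - Set.indicator {o} (fun _ => (1 : ℂ)) p.2‖ₑ ^ 2
      ≤ (if p.1 = o then (G.b o p.2 : ℝ≥0∞) else 0)
        + (if p.2 = o then (G.b o p.1 : ℝ≥0∞) else 0) := by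
    rintro ⟨x, y⟩
    by_cases hx : x = o <;> by_cases hy : y = o <;> simp [hx, hy, G.symm]
  have h1 : (∑' p : X × X, if p.1 = o then (G.b o p.2 : ℝ≥0∞) else 0)
      = ∑' y, (G.b o y : ℝ≥0∞) := by
    rw [ENNReal.tsum_prod' (f := fun p : X × X => if p.1 = o then (G.b o p.2 : ℝ≥0∞) else 0),
      tsum_eq_single o]
    · simp
    · intro x hx
      simp [hx]
  have h2 : (∑' p : X × X, if p.2 = o then (G.b o p.1 : ℝ≥0∞) else 0)
      = ∑' y, (G.b o y : ℝ≥0∞) := by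
    rw [ENNReal.tsum_prod' (f := fun p : X × X => if p.2 = o then (G.b o p.1 : ℝ≥0∞) else 0)]
    simp
  refine ENNReal.mul_lt_top (by simp) (lt_of_le_of_lt (ENNReal.tsum_le_tsum h) ?_)
  rw [ENNReal.tsum_add, h1, h2]
  exact ENNReal.add_lt_top.2 ⟨(hdeg o).lt_top, (hdeg o).lt_top⟩

/-! ### The Dirichlet form and the Dirichlet Laplacian on `ℓ²(X, m)`

The space `ℓ²(X, m)` is `Lp ℂ 2 m`. As every point has positive mass, almost everywhere equality
is equality and the elements of `Lp ℂ 2 m` are genuine functions. -/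

variable [MeasurableSpace X] (m : Measure X)

theorem eq_of_ae_eq {m : Measure X} (hm : ∀ x, 0 < m {x}) {f g : X → ℂ}
    (h : f =ᵐ[m] g) : f = g := by
  ext x
  by_contra hx
  have h0 : m {y | ¬ f y = g y} = 0 := ae_iff.1 h
  have h1 : m {x} ≤ m {y | ¬ f y = g y} := measure_mono (by simpa using hx)
  rw [h0] at h1
  exact absurd h1 (not_le.2 (hm x))

/-- The domain of the Dirichlet form `Q^(D)`: the closure of the finitely supported functions with
respect to the form norm `(Q̃ f + ‖f‖₂²) ^ (1/2)` on `{f ∈ ℓ²(X, m) | Q̃ f < ∞}`. On it `Q^(D)`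
is the restriction of `Q̃`. -/
def dirichletFormDomain (hm : ∀ x, 0 < m {x}) : Submodule ℂ (Lp ℂ 2 m) where
  carrier := {f | G.energy f < ∞ ∧ ∀ ε : ℝ≥0∞, 0 < ε →
    ∃ g : Lp ℂ 2 m, (Function.support g).Finite ∧ G.energy (f - g : Lp ℂ 2 m) + ‖f - g‖ₑ ^ 2 < ε}
  zero_mem' := by
    have h0 : ((0 : Lp ℂ 2 m) : X → ℂ) = 0 := eq_of_ae_eq hm (Lp.coeFn_zero ℂ 2 m)
    refine ⟨by rw [h0, energy_zero]; simp, fun ε hε => ⟨0, by rw [h0]; simp, ?_⟩⟩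
    rw [sub_zero, h0, energy_zero]
    simpa using hε
  add_mem' := by
    rintro f₁ f₂ ⟨h₁, k₁⟩ ⟨h₂, k₂⟩
    have hadd : ∀ u v : Lp ℂ 2 m, ((u + v : Lp ℂ 2 m) : X → ℂ) = u + v := fun u v =>
      eq_of_ae_eq hm (Lp.coeFn_add u v)
    refine ⟨?_, fun ε hε => ?_⟩
    · rw [hadd]
      exact (G.energy_add_le _ _).trans_lt
        (ENNReal.mul_lt_top (by simp) (ENNReal.add_lt_top.2 ⟨h₁, h₂⟩))
    · have hε' : 0 < ε / 4 := ENNReal.div_pos hε.ne' (by simp)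
      obtain ⟨g₁, s₁, e₁⟩ := k₁ _ hε'
      obtain ⟨g₂, s₂, e₂⟩ := k₂ _ hε'
      refine ⟨g₁ + g₂, ?_, ?_⟩
      · rw [hadd]
        exact (s₁.union s₂).subset (Function.support_add _ _)
      · have en : ‖(f₁ - g₁) + (f₂ - g₂)‖ₑ ^ 2 ≤ 2 * (‖f₁ - g₁‖ₑ ^ 2 + ‖f₂ - g₂‖ₑ ^ 2) := by
          have h : ‖(f₁ - g₁) + (f₂ - g₂)‖₊ ^ 2 ≤ 2 * (‖f₁ - g₁‖₊ ^ 2 + ‖f₂ - g₂‖₊ ^ 2) := by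
            rw [← NNReal.coe_le_coe]
            push_cast
            nlinarith [norm_add_le (f₁ - g₁) (f₂ - g₂), norm_nonneg ((f₁ - g₁) + (f₂ - g₂)),
              sq_nonneg (‖f₁ - g₁‖ - ‖f₂ - g₂‖)]
          simp only [enorm_eq_nnnorm]
          exact_mod_cast h
        have es : f₁ + f₂ - (g₁ + g₂) = (f₁ - g₁) + (f₂ - g₂) := by abel
        rw [es, hadd]
        calc _ ≤ 2 * (G.energy (f₁ - g₁ : Lp ℂ 2 m) + G.energy (f₂ - g₂ : Lp ℂ 2 m))
              + 2 * (‖f₁ - g₁‖ₑ ^ 2 + ‖f₂ - g₂‖ₑ ^ 2) :=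
              add_le_add (G.energy_add_le _ _) en
          _ = 2 * ((G.energy (f₁ - g₁ : Lp ℂ 2 m) + ‖f₁ - g₁‖ₑ ^ 2)
              + (G.energy (f₂ - g₂ : Lp ℂ 2 m) + ‖f₂ - g₂‖ₑ ^ 2)) := by ring
          _ < 2 * (ε / 4 + ε / 4) := by
              refine (ENNReal.mul_lt_mul_iff_right (by simp) (by simp)).2 ?_
              exact ENNReal.add_lt_add e₁ e₂
          _ = ε := by
              have h4 : (4 : ℝ≥0∞) = 2 * 2 := by norm_num
              rw [← two_mul, ← mul_assoc, ← h4]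
              exact ENNReal.mul_div_cancel (by simp) (by simp)
  smul_mem' := by
    rintro c f ⟨h, k⟩
    have hsmul : ∀ u : Lp ℂ 2 m, ((c • u : Lp ℂ 2 m) : X → ℂ) = c • u := fun u =>
      eq_of_ae_eq hm (Lp.coeFn_smul c u)
    refine ⟨?_, fun ε hε => ?_⟩
    · rw [hsmul, energy_smul]
      exact ENNReal.mul_lt_top (by simp) h
    · have hc : ‖c‖ₑ ^ 2 ≠ ∞ := by simp
      have hε' : 0 < ε / (‖c‖ₑ ^ 2 + 1) := ENNReal.div_pos hε.ne' (by simp)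
      obtain ⟨g, s, e⟩ := k _ hε'
      refine ⟨c • g, ?_, ?_⟩
      · rw [hsmul]
        exact s.subset (Function.support_const_smul_subset _ _)
      · rw [← smul_sub, hsmul, energy_smul, enorm_smul, mul_pow, ← mul_add]
        have h1 : G.energy (f - g : Lp ℂ 2 m) + ‖f - g‖ₑ ^ 2 ≠ ∞ := (e.trans_le le_top).ne
        by_cases h0 : G.energy (f - g : Lp ℂ 2 m) + ‖f - g‖ₑ ^ 2 = 0
        · rw [h0, mul_zero]; exact hε
        · calc _ < (‖c‖ₑ ^ 2 + 1) * (G.energy (f - g : Lp ℂ 2 m) + ‖f - g‖ₑ ^ 2) :=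
                (ENNReal.mul_lt_mul_iff_left h0 h1).2 (ENNReal.lt_add_right hc one_ne_zero)
            _ ≤ (‖c‖ₑ ^ 2 + 1) * (ε / (‖c‖ₑ ^ 2 + 1)) := by gcongr
            _ ≤ ε := ENNReal.mul_div_le

/-- The graph of the generator of `Q^(D)`: the pairs `(f, g)` with `f ∈ D(Q^(D))`, `g ∈ ℓ²(X, m)`
and `Q^(D)(h, f) = ⟨h, g⟩` for all `h ∈ D(Q^(D))`. -/
def dirichletLaplacianGraph (hm : ∀ x, 0 < m {x}) : Submodule ℂ (Lp ℂ 2 m × Lp ℂ 2 m) where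
  carrier := {u | u.1 ∈ G.dirichletFormDomain m hm ∧
    ∀ h ∈ G.dirichletFormDomain m hm, G.energyForm h u.1 = ⟪h, u.2⟫_ℂ}
  zero_mem' := by
    refine ⟨Submodule.zero_mem _, fun h _ => ?_⟩
    have h0 : ((0 : Lp ℂ 2 m) : X → ℂ) = 0 := eq_of_ae_eq hm (Lp.coeFn_zero ℂ 2 m)
    simp only [Prod.fst_zero, Prod.snd_zero, inner_zero_right, h0]
    simp [energyForm]
  add_mem' := by
    rintro ⟨f₁, g₁⟩ ⟨f₂, g₂⟩ ⟨h₁, k₁⟩ ⟨h₂, k₂⟩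
    refine ⟨Submodule.add_mem _ h₁ h₂, fun h hh => ?_⟩
    have hadd : ((f₁ + f₂ : Lp ℂ 2 m) : X → ℂ) = f₁ + f₂ :=
      eq_of_ae_eq hm (Lp.coeFn_add f₁ f₂)
    change G.energyForm h (f₁ + f₂ : Lp ℂ 2 m) = ⟪h, g₁ + g₂⟫_ℂ
    rw [hadd, G.energyForm_add_right h₁.1 h₂.1 hh.1, inner_add_right]
    exact congrArg₂ _ (k₁ h hh) (k₂ h hh)
  smul_mem' := by
    rintro c ⟨f, g⟩ ⟨h₁, k₁⟩
    refine ⟨Submodule.smul_mem _ c h₁, fun h hh => ?_⟩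
    have hsmul : ((c • f : Lp ℂ 2 m) : X → ℂ) = c • f := eq_of_ae_eq hm (Lp.coeFn_smul c f)
    change G.energyForm h (c • f : Lp ℂ 2 m) = ⟪h, c • g⟫_ℂ
    rw [hsmul, energyForm_smul_right, inner_smul_right]
    exact congrArg _ (k₁ h hh)

theorem indicator_mem_dirichletFormDomain [MeasurableSingletonClass X] [IsFiniteMeasure m]
    (hm : ∀ x, 0 < m {x}) (o : X) :
    indicatorConstLp 2 (measurableSet_singleton o) (measure_ne_top m {o}) (1 : ℂ)
      ∈ G.dirichletFormDomain m hm := by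
  have h : (indicatorConstLp 2 (measurableSet_singleton o) (measure_ne_top m {o}) (1 : ℂ) :
      X → ℂ) = Set.indicator {o} fun _ => (1 : ℂ) := eq_of_ae_eq hm indicatorConstLp_coeFn
  have h0 : ((0 : Lp ℂ 2 m) : X → ℂ) = 0 := eq_of_ae_eq hm (Lp.coeFn_zero ℂ 2 m)
  refine ⟨by rw [h]; exact G.energy_indicator_lt_top o, fun ε hε =>
    ⟨indicatorConstLp 2 (measurableSet_singleton o) (measure_ne_top m {o}) 1, ?_, ?_⟩⟩
  · rw [h]
    exact (Set.finite_singleton o).subset Set.support_indicator_subset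
  · rw [sub_self, h0, energy_zero]
    simpa using hε

/-- The generator is single valued, as `D(Q^(D))` contains the indicators of points. -/
theorem dirichletLaplacianGraph_single_valued [MeasurableSingletonClass X] [IsFiniteMeasure m]
    (hm : ∀ x, 0 < m {x}) (u : Lp ℂ 2 m × Lp ℂ 2 m) (hu : u ∈ G.dirichletLaplacianGraph m hm)
    (hu0 : u.1 = 0) : u.2 = 0 := by
  have h0 : ((0 : Lp ℂ 2 m) : X → ℂ) = 0 := eq_of_ae_eq hm (Lp.coeFn_zero ℂ 2 m)
  have key : ∀ x, u.2 x = 0 := by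
    intro x
    have h1 := hu.2 _ (G.indicator_mem_dirichletFormDomain m hm x)
    rw [hu0, h0, L2.inner_indicatorConstLp_one, integral_singleton] at h1
    have h2 : m.real {x} ≠ 0 := (ENNReal.toReal_pos (hm x).ne' (measure_ne_top m _)).ne'
    have h3 : m.real {x} • u.2 x = 0 := by
      rw [← h1]
      simp [energyForm]
    exact (smul_eq_zero.1 h3).resolve_left h2
  refine Lp.ext ?_
  rw [h0]
  exact Eventually.of_forall key

/-- The Dirichlet Laplacian `L^(D)`: the generator of the Dirichlet form `Q^(D)`, as an unbounded
operator on `ℓ²(X, m)`. -/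
def dirichletLaplacian (hm : ∀ x, 0 < m {x}) : Lp ℂ 2 m →ₗ.[ℂ] Lp ℂ 2 m :=
  (G.dirichletLaplacianGraph m hm).toLinearPMap

theorem dirichletLaplacian_graph [MeasurableSingletonClass X] [IsFiniteMeasure m]
    (hm : ∀ x, 0 < m {x}) :
    (G.dirichletLaplacian m hm).graph = G.dirichletLaplacianGraph m hm :=
  Submodule.toLinearPMap_graph_eq _ (G.dirichletLaplacianGraph_single_valued m hm)

end WeightedGraph

/-- `ev` lists the eigenvalues `ev 0 ≤ ev 1 ≤ …`, counted with multiplicity, of an operator `L`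
with purely discrete spectrum (on a Hilbert space of countably infinite dimension): there is an
orthonormal basis of eigenvectors for these eigenvalues, and the eigenvalues tend to infinity. -/
def IsEigenvalueSequence {E : Type*} [NormedAddCommGroup E] [InnerProductSpace ℂ E]
    (L : E →ₗ.[ℂ] E) (ev : ℕ → ℝ) : Prop :=
  Monotone ev ∧ Tendsto ev atTop atTop ∧
    ∃ φ : HilbertBasis ℕ ℂ E, ∀ k, ∃ h : φ k ∈ L.domain, L ⟨φ k, h⟩ = (ev k : ℂ) • φ k

end

/-! Enumerate the vertices and give the `n`-th one (counting from 0) the mass `(n + 1) ^ (-(1 + ε /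
2))`; the total mass is finite. Two independent arguments then suffice.

Discreteness holds for every finite measure of full support. Functions in the form domain lie in
`D̃₀`, so uniform transience bounds them in the sup norm by the form norm. Cutting such a function
off outside a finite set costs at most this bound times the mass of the complement, so the embedding
`J` of the form domain into `ℓ²` is a norm limit of finite rank operators. The spectral theorem for
`J J*` (`exists_hilbertBasis_of_embedding`) gives the eigenbasis in `exists_isEigenvalueSequence`.

Growth is a min-max estimate (`eigenvalue_le`). A nonzero combination of the first `k + 1` point
indicators can be made orthogonal to the first `k` eigenvectors, and its energy is at most `2 ∑ deg
|f|²`. If `deg ≤ K`, then `deg ≤ K (k + 1) ^ (1 + ε / 2) m` on these vertices, so `ev k ≤ 2 K (k +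
1) ^ (1 + ε / 2)`; the remaining factor `(k + 1) ^ (-(ε / 2))` tends to zero. -/

section Hilbert

/-! ### Spectral theory in Hilbert space -/

variable {E : Type*} [NormedAddCommGroup E] [InnerProductSpace ℂ E]

/-- A compact operator has, in an orthonormal family, only finitely many eigenvectors whose
eigenvalues are bounded away from zero. -/
theorem IsCompactOperator.finite_setOf_le_eigenvalue {S : E →L[ℂ] E} (hS : IsCompactOperator S)
    {ι : Type*} {v : ι → E} (hv : Orthonormal ℂ v) {μ : ι → ℝ}
    (hμ : ∀ i, S (v i) = (μ i : ℂ) • v i) {c : ℝ} (hc : 0 < c) : {i | c ≤ μ i}.Finite := by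
  by_contra hinf
  have hinf : {i | c ≤ μ i}.Infinite := hinf
  set s := hinf.natEmbedding with hs
  obtain ⟨a, -, θ, hθ, hlim⟩ := (hS.isCompact_closure_image_closedBall 1).tendsto_subseq
    (x := fun n => S (v (s n))) fun n => subset_closure
      ⟨v (s n), by simp [hv.1], rfl⟩
  obtain ⟨N, hN⟩ := Metric.cauchySeq_iff.1 hlim.cauchySeq c hc
  have h1 := hN N le_rfl (N + 1) (Nat.le_succ N)
  have hne : (s (θ N) : ι) ≠ s (θ (N + 1)) := fun h =>
    (hθ (Nat.lt_succ_self N)).ne (s.injective (Subtype.ext h))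
  simp only [Function.comp_apply, hμ, dist_eq_norm] at h1
  -- By orthogonality the images of two distinct members are at distance at least `√2 c`, so no
  -- subsequence of images is Cauchy.
  have h2 := norm_sub_sq (𝕜 := ℂ) ((μ (s (θ N)) : ℂ) • v (s (θ N)))
    ((μ (s (θ (N + 1))) : ℂ) • v (s (θ (N + 1))))
  rw [inner_smul_left, inner_smul_right, hv.2 hne] at h2
  simp only [norm_smul, hv.1, Complex.norm_real, mul_zero, map_zero, mul_one, sub_zero,
    Real.norm_eq_abs, sq_abs] at h2
  have h3 : c ≤ μ (s (θ N)) := (s (θ N)).2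
  have h4 : c ≤ μ (s (θ (N + 1))) := (s (θ (N + 1))).2
  nlinarith [norm_nonneg ((μ (s (θ N)) : ℂ) • v (s (θ N))
    - (μ (s (θ (N + 1))) : ℂ) • v (s (θ (N + 1))))]

/-- A family of positive reals with only finitely many members above every positive level can be
enumerated in decreasing order. -/
theorem exists_equiv_nat_antitone {ι : Type*} [Infinite ι] {μ : ι → ℝ} (hpos : ∀ i, 0 < μ i)
    (hfin : ∀ c : ℝ, 0 < c → {i | c ≤ μ i}.Finite) :
    ∃ σ : ℕ ≃ ι, Antitone (μ ∘ σ) := by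
  classical
  have hcount : Countable ι := by
    have h : (Set.univ : Set ι) = ⋃ n : ℕ, {i | 1 / ((n : ℝ) + 1) ≤ μ i} := by
      refine (Set.eq_univ_of_forall fun i => ?_).symm
      obtain ⟨n, hn⟩ := exists_nat_one_div_lt (hpos i)
      exact Set.mem_iUnion.2 ⟨n, hn.le⟩
    refine Set.countable_univ_iff.1 (h ▸ Set.countable_iUnion fun n => ?_)
    exact (hfin _ (by positivity)).countable
  obtain ⟨e, he⟩ := exists_injective_nat ι
  -- The injection `e` into `ℕ` breaks ties between equal values, which makes the order strict while
  -- every initial segment stays finite.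
  let key : ι → ℝᵒᵈ ×ₗ ℕ := fun i => toLex (OrderDual.toDual (μ i), e i)
  have hkey : Function.Injective key := fun i j h => he (congrArg (fun z => (ofLex z).2) h)
  have hkey_le : ∀ i j, key i ≤ key j → μ j ≤ μ i := fun i j h => by
    rcases Prod.Lex.le_iff.1 h with h | h
    · exact (OrderDual.toDual_lt_toDual.1 h).le
    · exact (OrderDual.toDual_inj.1 h.1).ge
  have hbelow : ∀ i, {j | key j < key i}.Finite := fun i =>
    (hfin (μ i) (hpos i)).subset fun j hj => hkey_le _ _ (le_of_lt hj)
  let r : ι → ℕ := fun i => (hbelow i).toFinset.card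
  have hr : ∀ i j, key i < key j → r i < r j := fun i j h => by
    refine Finset.card_lt_card ((Finset.ssubset_iff_of_subset ?_).2 ⟨i, by simpa using h, by simp⟩)
    intro l hl
    simp only [Set.Finite.mem_toFinset, Set.mem_ofPred_eq] at hl ⊢
    exact hl.trans h
  have hr_inj : Function.Injective r := fun i j h => hkey <| by
    rcases lt_trichotomy (key i) (key j) with h' | h' | h'
    · exact absurd h (hr _ _ h').ne
    · exact h'
    · exact absurd h (hr _ _ h').ne'
  -- The rank `r` need not be shown surjective: its infinite range in `ℕ` is enumerated
  -- increasingly.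
  have : Infinite (Set.range r) := (Set.infinite_range_of_injective hr_inj).to_subtype
  refine ⟨(Nat.Subtype.orderIsoOfNat (Set.range r)).toEquiv.trans
    (Equiv.ofInjective r hr_inj).symm, fun a b hab => hkey_le _ _ ?_⟩
  by_contra! hlt
  have h1 := hr _ _ hlt
  simp only [Equiv.trans_apply, Equiv.apply_ofInjective_symm] at h1
  have h2 := (Nat.Subtype.orderIsoOfNat (Set.range r)).monotone hab
  exact absurd h1 (not_lt.2 h2)

/-- **Spectral theorem** for a compact positive definite operator on an infinite dimensional Hilbert
space, with the eigenvalues in decreasing order. -/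
theorem IsCompactOperator.exists_hilbertBasis_antitone [CompleteSpace E] {S : E →L[ℂ] E}
    (hS : IsCompactOperator S) (hsymm : (S : E →ₗ[ℂ] E).IsSymmetric)
    (hpos : ∀ x, x ≠ 0 → 0 < RCLike.re ⟪S x, x⟫_ℂ) (hinf : ¬ FiniteDimensional ℂ E) :
    ∃ (μ : ℕ → ℝ) (φ : HilbertBasis ℕ ℂ E), Antitone μ ∧ (∀ k, 0 < μ k) ∧
      Tendsto μ atTop (𝓝 0) ∧ ∀ k, S (φ k) = (μ k : ℂ) • φ k := by
  let V : ℂ → Submodule ℂ E := fun a => Module.End.eigenspace (S : E →ₗ[ℂ] E) a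
  have hV : ∀ a, IsClosed (V a : Set E) := fun a => by
    have h : (V a : Set E) = {x | S x = a • x} := by
      ext x
      exact Module.End.mem_eigenspace_iff
    rw [h]
    exact isClosed_eq S.continuous (continuous_const_smul a)
  have hVc : ∀ a, CompleteSpace (V a) := fun a => (hV a).completeSpace_coe
  -- The basis is the union of Hilbert bases of all eigenspaces; `w a` is empty when `a` is not an
  -- eigenvalue.
  choose w b _ using fun a => exists_hilbertBasis ℂ (V a)
  let v : (Σ a, w a) → E := fun i => ((b i.1 i.2 : V i.1) : E)
  have hv : Orthonormal ℂ v :=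
    (hsymm.orthogonalFamily_eigenspaces).orthonormal_sigma_orthonormal fun a => (b a).orthonormal
  have hSv : ∀ i, S (v i) = i.1 • v i := fun i =>
    Module.End.mem_eigenspace_iff.1 (b i.1 i.2).2
  have hvv : ∀ i, ⟪v i, v i⟫_ℂ = 1 := fun i => by
    rw [inner_self_eq_norm_sq_to_K, hv.1 i]; simp
  have hreal : ∀ i : Σ a, w a, ((i.1.re : ℝ) : ℂ) = i.1 := fun i => by
    have h := hsymm (v i) (v i)
    simp only [ContinuousLinearMap.coe_coe, hSv, inner_smul_left, inner_smul_right, hvv,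
      mul_one] at h
    exact Complex.conj_eq_iff_re.1 h
  have hSv' : ∀ i, S (v i) = ((i.1.re : ℝ) : ℂ) • v i := fun i => by rw [hreal, hSv]
  have hμpos : ∀ i : Σ a, w a, 0 < i.1.re := fun i => by
    have h := hpos (v i) (hv.ne_zero i)
    rw [hSv', inner_smul_left, hvv] at h
    simpa using h
  have hspan : (Submodule.span ℂ (Set.range v))ᗮ = ⊥ := by
    rw [eq_bot_iff, ← ContinuousLinearMap.orthogonalComplement_iSup_eigenspaces_eq_bot hS hsymm]
    intro x hx
    rw [Submodule.mem_orthogonal] at hx ⊢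
    intro y hy
    refine Submodule.iSup_induction _ (motive := fun y => ⟪y, x⟫_ℂ = 0) hy (fun a y hy => ?_)
      (by simp) fun y z h1 h2 => by rw [inner_add_left, h1, h2, add_zero]
    -- Expand `y` in the basis of its eigenspace and apply the continuous functional `⟪x, ·⟫` term
    -- by term; every term vanishes.
    have h1 := ((b a).hasSum_repr ⟨y, hy⟩).mapL (V a).subtypeL
    have h2 := h1.mapL (innerSL ℂ x)
    rw [← inner_conj_symm, map_eq_zero]
    refine h2.unique ?_
    convert hasSum_zero with j
    have h3 := hx (v ⟨a, j⟩) (Submodule.subset_span ⟨_, rfl⟩)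
    rw [← inner_conj_symm, map_eq_zero] at h3
    simp only [map_smul, Submodule.subtypeL_apply, innerSL_apply_apply]
    rw [h3, smul_zero]
  have hιinf : Infinite (Σ a, w a) := by
    by_contra h
    have : Finite (Σ a, w a) := not_infinite_iff_finite.1 h
    have := Fintype.ofFinite (Σ a, w a)
    exact hinf (((HilbertBasis.mkOfOrthogonalEqBot hv hspan).toOrthonormalBasis).toBasis
      |>.finiteDimensional_of_finite)
  have hfin := fun c hc => hS.finite_setOf_le_eigenvalue hv hSv' (c := c) hc
  obtain ⟨σ, hσ⟩ := exists_equiv_nat_antitone hμpos hfin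
  have hvσ : Orthonormal ℂ (v ∘ σ) := hv.comp _ σ.injective
  have hspanσ : (Submodule.span ℂ (Set.range (v ∘ σ)))ᗮ = ⊥ := by
    rw [σ.surjective.range_comp, hspan]
  refine ⟨_, HilbertBasis.mkOfOrthogonalEqBot hvσ hspanσ, hσ, fun k => hμpos _, ?_, fun k => ?_⟩
  · rw [Metric.tendsto_atTop]
    intro c hc
    have h1 : (σ ⁻¹' {i | c ≤ i.1.re}).Finite := (hfin c hc).preimage σ.injective.injOn
    obtain ⟨N, hN⟩ := h1.bddAbove
    refine ⟨N + 1, fun n hn => ?_⟩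
    rw [Real.dist_0_eq_abs, Function.comp_apply, abs_of_pos (hμpos _)]
    by_contra! h
    have := hN h
    omega
  · rw [HilbertBasis.coe_mkOfOrthogonalEqBot]
    exact hSv' (σ k)

/-- Simultaneous diagonalization of two inner products: for a compact embedding `J` with
dense range, there is a Hilbert basis of `E` consisting of vectors `J (u k)` for which `⟪v, u k⟫` is a multiple of
`⟪J v, J (u k)⟫`. -/
theorem IsCompactOperator.exists_hilbertBasis_of_embedding [CompleteSpace E] {V : Type*}
    [NormedAddCommGroup V] [InnerProductSpace ℂ V] [CompleteSpace V] {J : V →L[ℂ] E}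
    (hJ : IsCompactOperator J) (hdense : ∀ f, (∀ u, ⟪J u, f⟫_ℂ = 0) → f = 0)
    (hinf : ¬ FiniteDimensional ℂ E) :
    ∃ (ν : ℕ → ℝ) (φ : HilbertBasis ℕ ℂ E) (u : ℕ → V), Monotone ν ∧ Tendsto ν atTop atTop ∧
      (∀ k, J (u k) = φ k) ∧ ∀ v k, ⟪v, u k⟫_ℂ = ν k * ⟪J v, φ k⟫_ℂ := by
  set S : E →L[ℂ] E := J.comp J.adjoint with hS
  have hinner : ∀ f g, ⟪S f, g⟫_ℂ = ⟪J.adjoint f, J.adjoint g⟫_ℂ := fun f g => by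
    rw [hS, ContinuousLinearMap.comp_apply, ← ContinuousLinearMap.adjoint_inner_right]
  have hsymm : (S : E →ₗ[ℂ] E).IsSymmetric := fun f g => by
    simp only [ContinuousLinearMap.coe_coe]
    rw [hinner, ← inner_conj_symm f, hinner, inner_conj_symm]
  -- Positivity of `J J*` is injectivity of `J*`, which is the density of the range of `J`.
  have hpos : ∀ f, f ≠ 0 → 0 < RCLike.re ⟪S f, f⟫_ℂ := fun f hf => by
    rw [hinner, inner_self_eq_norm_sq]
    refine pow_pos (norm_pos_iff.2 fun h => hf (hdense f fun u => ?_)) 2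
    rw [← ContinuousLinearMap.adjoint_inner_right, h, inner_zero_right]
  obtain ⟨μ, φ, hanti, hμ, hlim, hφ⟩ :=
    (hJ.comp_clm J.adjoint : IsCompactOperator S).exists_hilbertBasis_antitone hsymm hpos hinf
  -- From `J J* φ = μ φ`, the vector `u = μ⁻¹ J* φ` is the preimage of `φ`, and moving `J*` across
  -- the inner product gives the factor `ν = μ⁻¹`.
  refine ⟨fun k => (μ k)⁻¹, φ, fun k => (μ k : ℂ)⁻¹ • J.adjoint (φ k),
    fun a b hab => inv_anti₀ (hμ b) (hanti hab), ?_, fun k => ?_, fun v k => ?_⟩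
  · exact (tendsto_nhdsWithin_iff.2 ⟨hlim, Eventually.of_forall hμ⟩).inv_tendsto_nhdsGT_zero
  · have hk : (μ k : ℂ) ≠ 0 := by exact_mod_cast (hμ k).ne'
    rw [map_smul]
    exact (inv_smul_eq_iff₀ hk).2 (hφ k)
  · rw [inner_smul_right, ContinuousLinearMap.adjoint_inner_right]
    push_cast
    rfl

/-- The easy half of the min-max principle: a vector that is orthogonal to the first `k`
eigenvectors of a form `v ↦ ‖B v‖ ^ 2` has Rayleigh quotient at least `ev k`. -/
theorem HilbertBasis.eigenvalue_mul_norm_sq_le {H V : Type*} [NormedAddCommGroup H]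
    [InnerProductSpace ℂ H] [AddCommGroup V] [Module ℂ V] (A : V →ₗ[ℂ] E) (B : V →ₗ[ℂ] H)
    (φ : HilbertBasis ℕ ℂ E) {ev : ℕ → ℝ} (hev : Monotone ev) {w : ℕ → V} (hA : ∀ i, A (w i) = φ i)
    (hB : ∀ v i, ⟪B v, B (w i)⟫_ℂ = ev i * ⟪A v, φ i⟫_ℂ) {k : ℕ} {v : V}
    (hv : ∀ i < k, ⟪φ i, A v⟫_ℂ = 0) : ev k * ‖A v‖ ^ 2 ≤ ‖B v‖ ^ 2 := by
  have hsum : HasSum (fun i => ev k * ‖⟪φ i, A v⟫_ℂ‖ ^ 2) (ev k * ‖A v‖ ^ 2) := by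
    refine HasSum.mul_left _ ?_
    have h := φ.hasSum_inner_mul_inner (A v) (A v)
    rw [inner_self_eq_norm_sq_to_K] at h
    have h' : ∀ i, ⟪A v, φ i⟫_ℂ * ⟪φ i, A v⟫_ℂ = ((‖⟪φ i, A v⟫_ℂ‖ ^ 2 : ℝ) : ℂ) := fun i => by
      rw [← inner_conj_symm (A v) (φ i), Complex.conj_mul']
      push_cast
      rfl
    simp only [h'] at h
    exact Complex.hasSum_ofReal.1 (by simpa using h)
  -- Finite truncations `p` of the expansion of `v` suffice, so no convergence in `V` is needed: `B
  -- (v - p)` is orthogonal to `B p`, and Pythagoras bounds `‖B v‖ ^ 2` below by the partial sum.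
  refine le_of_tendsto' hsum.tendsto_sum_nat fun N => ?_
  set a : ℕ → ℂ := fun i => ⟪φ i, A v⟫_ℂ with ha
  set p : V := ∑ i ∈ Finset.range N, a i • w i with hp
  have hAp : ∀ i < N, ⟪A p, φ i⟫_ℂ = conj (a i) := fun i hi => by
    rw [hp, map_sum]
    simp only [map_smul, hA]
    rw [φ.orthonormal.inner_left_sum _ (Finset.mem_range.2 hi)]
  have horth : ⟪B (v - p), B p⟫_ℂ = 0 := by
    conv_lhs => rw [hp, map_sum, inner_sum]
    refine Finset.sum_eq_zero fun i hi => ?_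
    rw [map_smul, inner_smul_right, hB, map_sub A, inner_sub_left, hAp i (Finset.mem_range.1 hi),
      ha, inner_conj_symm]
    simp
  have hBp : ⟪B p, B p⟫_ℂ = ((∑ i ∈ Finset.range N, ev i * ‖a i‖ ^ 2 : ℝ) : ℂ) := by
    have h : B p = ∑ i ∈ Finset.range N, B (a i • w i) := by rw [hp, map_sum]
    conv_lhs => arg 3; rw [h]
    rw [inner_sum]
    push_cast
    refine Finset.sum_congr rfl fun i hi => ?_
    rw [map_smul, inner_smul_right, hB, hAp i (Finset.mem_range.1 hi), mul_left_comm,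
      Complex.mul_conj']
  have hBp' : ‖B p‖ ^ 2 = ∑ i ∈ Finset.range N, ev i * ‖a i‖ ^ 2 := by
    rw [inner_self_eq_norm_sq_to_K] at hBp
    exact Complex.ofReal_injective (by simpa using hBp)
  have hpyth : ‖B v‖ ^ 2 = ‖B (v - p)‖ ^ 2 + ‖B p‖ ^ 2 := by
    have h : B v = B (v - p) + B p := by rw [← map_add, sub_add_cancel]
    have h2 := norm_add_sq_eq_norm_sq_add_norm_sq_of_inner_eq_zero _ _ horth
    rw [h]
    simpa only [sq] using h2
  calc ∑ i ∈ Finset.range N, ev k * ‖a i‖ ^ 2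
      ≤ ∑ i ∈ Finset.range N, ev i * ‖a i‖ ^ 2 := by
        refine Finset.sum_le_sum fun i _ => ?_
        rcases lt_or_ge i k with h | h
        · simp [ha, hv i h]
        · exact mul_le_mul_of_nonneg_right (hev h) (by positivity)
    _ ≤ ‖B v‖ ^ 2 := by rw [hpyth, hBp']; linarith [sq_nonneg ‖B (v - p)‖]

end Hilbert

/-- For a pair `(f, grad f)` the right side is the squared form norm, in the order used in
`dirichletFormDomain`. -/
theorem WithLp.prod_enorm_sq_eq_add {E F : Type*} [NormedAddCommGroup E] [NormedAddCommGroup F]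
    (u : WithLp 2 (E × F)) :
    ‖u‖ₑ ^ 2 = ‖u.snd‖ₑ ^ 2 + ‖u.fst‖ₑ ^ 2 := by
  simp only [← ofReal_norm, ← ENNReal.ofReal_pow (norm_nonneg _)]
  rw [← ENNReal.ofReal_add (by positivity) (by positivity), WithLp.prod_norm_sq_eq_of_L2, add_comm]

/-! ### Functions and finite-rank cut-offs in `ℓ²(X, m)` -/

section LpDiscrete

variable {X : Type*} [MeasurableSpace X] {m : Measure X}

theorem Lp.coeFn_add_eq (hm : ∀ x, 0 < m {x}) (f g : Lp ℂ 2 m) :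
    ((f + g : Lp ℂ 2 m) : X → ℂ) = f + g :=
  WeightedGraph.eq_of_ae_eq hm (Lp.coeFn_add f g)

theorem Lp.coeFn_sub_eq (hm : ∀ x, 0 < m {x}) (f g : Lp ℂ 2 m) :
    ((f - g : Lp ℂ 2 m) : X → ℂ) = f - g :=
  WeightedGraph.eq_of_ae_eq hm (Lp.coeFn_sub f g)

theorem Lp.coeFn_smul_eq (hm : ∀ x, 0 < m {x}) (c : ℂ) (f : Lp ℂ 2 m) :
    ((c • f : Lp ℂ 2 m) : X → ℂ) = c • (f : X → ℂ) :=
  WeightedGraph.eq_of_ae_eq hm (Lp.coeFn_smul c f)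

theorem Lp.coeFn_zero_eq (hm : ∀ x, 0 < m {x}) : ((0 : Lp ℂ 2 m) : X → ℂ) = 0 :=
  WeightedGraph.eq_of_ae_eq hm (Lp.coeFn_zero ℂ 2 m)

theorem Lp.ext_apply {f g : Lp ℂ 2 m} (h : ∀ x, f x = g x) : f = g :=
  Lp.ext (Eventually.of_forall h)

theorem Lp.coeFn_sum_eq (hm : ∀ x, 0 < m {x}) {ι : Type*} (s : Finset ι) (f : ι → Lp ℂ 2 m)
    (x : X) : (∑ i ∈ s, f i : Lp ℂ 2 m) x = ∑ i ∈ s, f i x := by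
  classical
  induction s using Finset.induction_on with
  | empty => rw [Finset.sum_empty, Finset.sum_empty, Lp.coeFn_zero_eq hm, Pi.zero_apply]
  | insert i s hi ih => rw [Finset.sum_insert hi, Lp.coeFn_add_eq hm, Pi.add_apply, ih,
      Finset.sum_insert hi]

theorem real_singleton_pos [IsFiniteMeasure m] (hm : ∀ x, 0 < m {x}) (x : X) : 0 < m.real {x} :=
  ENNReal.toReal_pos (hm x).ne' (measure_ne_top m _)

variable [DiscreteMeasurableSpace X]

theorem MeasureTheory.Lp.enorm_sq_eq_tsum [Countable X] (f : Lp ℂ 2 m) :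
    ‖f‖ₑ ^ 2 = ∑' x, ‖f x‖ₑ ^ 2 * m {x} := by
  have h := eLpNorm_nnreal_pow_eq_lintegral (f := f) (μ := m) (p := 2) (by simp)
  rw [← lintegral_countable' fun x => ‖f x‖ₑ ^ 2, Lp.enorm_def]
  simpa using h

theorem MeasureTheory.Lp.enorm_apply_sq_mul_le [Countable X] (f : Lp ℂ 2 m) (x : X) :
    ‖f x‖ₑ ^ 2 * m {x} ≤ ‖f‖ₑ ^ 2 := by
  rw [Lp.enorm_sq_eq_tsum]
  exact ENNReal.le_tsum (f := fun x => ‖f x‖ₑ ^ 2 * m {x}) x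

variable [IsFiniteMeasure m]

/-- The indicator of a point, as an element of `ℓ²(X, m)`. -/
noncomputable def pointLp (m : Measure X) [IsFiniteMeasure m] (x : X) : Lp ℂ 2 m :=
  indicatorConstLp 2 (measurableSet_singleton x) (measure_ne_top m {x}) (1 : ℂ)

theorem coe_pointLp (hm : ∀ x, 0 < m {x}) (x : X) :
    (pointLp m x : X → ℂ) = Set.indicator {x} fun _ => 1 :=
  WeightedGraph.eq_of_ae_eq hm indicatorConstLp_coeFn

theorem inner_pointLp (x : X) (f : Lp ℂ 2 m) : ⟪pointLp m x, f⟫_ℂ = m.real {x} * f x := by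
  rw [pointLp, L2.inner_indicatorConstLp_one, integral_singleton]
  simp

/-- As the point has positive mass, evaluation is a multiple of the inner product with its
indicator. This lets pointwise identities pass to closures. -/
theorem continuous_Lp_apply (hm : ∀ x, 0 < m {x}) (x : X) :
    Continuous fun f : Lp ℂ 2 m => f x := by
  have h : (fun f : Lp ℂ 2 m => f x) = fun f => (m.real {x} : ℂ)⁻¹ * ⟪pointLp m x, f⟫_ℂ := by
    ext f
    rw [inner_pointLp, inv_mul_cancel_left₀]
    exact_mod_cast (real_singleton_pos hm x).ne'
  rw [h]
  fun_prop

theorem linearIndependent_pointLp (hm : ∀ x, 0 < m {x}) : LinearIndependent ℂ (pointLp m) := by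
  refine linearIndependent_of_ne_zero_of_inner_eq_zero (fun x h => ?_) fun x y hxy => ?_
  · have h1 := congrFun (coe_pointLp hm x) x
    rw [h, Lp.coeFn_zero_eq hm] at h1
    simp at h1
  · change ⟪pointLp m x, pointLp m y⟫_ℂ = 0
    rw [inner_pointLp, coe_pointLp hm]
    simp [hxy]

theorem not_finiteDimensional_Lp [Infinite X] (hm : ∀ x, 0 < m {x}) :
    ¬ FiniteDimensional ℂ (Lp ℂ 2 m) := fun _ =>
  not_finite_iff_infinite.2 ‹Infinite X› (linearIndependent_pointLp hm).finite

/-- The orthogonal projection onto the functions supported on a finite set. -/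
noncomputable def finsetProj (m : Measure X) [IsFiniteMeasure m] (s : Finset X) :
    Lp ℂ 2 m →L[ℂ] Lp ℂ 2 m :=
  ∑ x ∈ s, (innerSL ℂ (pointLp m x)).smulRight ((m.real {x} : ℂ)⁻¹ • pointLp m x)

theorem finsetProj_apply (hm : ∀ x, 0 < m {x}) (s : Finset X) (f : Lp ℂ 2 m) (y : X) :
    finsetProj m s f y = (s : Set X).indicator f y := by
  classical
  have h : finsetProj m s f = ∑ x ∈ s, f x • pointLp m x := by
    rw [finsetProj, _root_.sum_apply]
    refine Finset.sum_congr rfl fun x _ => ?_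
    have : (m.real {x} : ℂ) ≠ 0 := by exact_mod_cast (real_singleton_pos hm x).ne'
    rw [ContinuousLinearMap.smulRight_apply, innerSL_apply_apply, inner_pointLp, smul_smul]
    congr 1
    field_simp
  rw [h, Lp.coeFn_sum_eq hm]
  simp [Lp.coeFn_smul_eq hm, coe_pointLp hm, Set.indicator_apply, Pi.single_apply]

theorem isCompactOperator_finsetProj (s : Finset X) : IsCompactOperator (finsetProj m s) := by
  classical
  rw [finsetProj]
  induction s using Finset.induction_on with
  | empty => exact isCompactOperator_zero
  | insert x s hx ih =>
    rw [Finset.sum_insert hx]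
    refine IsCompactOperator.add (f := (innerSL ℂ (pointLp m x)).smulRight
      ((m.real {x} : ℂ)⁻¹ • pointLp m x)) ?_ ih
    exact (isCompactOperator_of_locallyCompactSpace_dom (innerSL ℂ (pointLp m x))).clm_comp
      (ContinuousLinearMap.toSpanSingleton ℂ ((m.real {x} : ℂ)⁻¹ • pointLp m x))

/-- Only vertices outside `s` contribute, each at most `c` times its mass. This is how a sup bound
and a finite measure together yield compactness. -/
theorem enorm_sub_finsetProj_sq_le [Countable X] (hm : ∀ x, 0 < m {x}) (s : Finset X)
    (f : Lp ℂ 2 m) {c : ℝ≥0∞} (hc : ∀ x, ‖f x‖ₑ ^ 2 ≤ c) :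
    ‖f - finsetProj m s f‖ₑ ^ 2 ≤ c * m (s : Set X)ᶜ := by
  classical
  rw [Lp.enorm_sq_eq_tsum, ← lintegral_indicator_one (Set.to_countable _).measurableSet,
    lintegral_countable', ← ENNReal.tsum_mul_left]
  refine ENNReal.tsum_le_tsum fun x => ?_
  rw [Lp.coeFn_sub_eq hm, Pi.sub_apply, finsetProj_apply hm, ← mul_assoc]
  gcongr
  by_cases hx : x ∈ s <;> simp [hx, hc x]

end LpDiscrete

/-! ### The form domain as a Hilbert space of pairs (function, gradient) -/

namespace WeightedGraph

variable {X : Type*} (G : WeightedGraph X)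

/-- The discrete gradient, normalized such that `Q̃ f` is the square of its `ℓ²` norm. -/
noncomputable def grad (f : X → ℂ) (p : X × X) : ℂ :=
  (√(G.b p.1 p.2 / 2) : ℝ) * (f p.1 - f p.2)

theorem grad_sub (f g : X → ℂ) : G.grad (f - g) = G.grad f - G.grad g := by
  ext p
  simp only [grad, Pi.sub_apply]
  ring

theorem norm_grad_sq (f : X → ℂ) (p : X × X) :
    ‖G.grad f p‖ ^ 2 = G.b p.1 p.2 * ‖f p.1 - f p.2‖ ^ 2 / 2 := by
  rw [grad, norm_mul, mul_pow, Complex.norm_real, Real.norm_eq_abs, sq_abs,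
    Real.sq_sqrt (by positivity)]
  ring

theorem enorm_grad_sq (f : X → ℂ) (p : X × X) :
    ‖G.grad f p‖ₑ ^ 2 = 2⁻¹ * ((G.b p.1 p.2 : ℝ≥0∞) * ‖f p.1 - f p.2‖ₑ ^ 2) := by
  have h := congrArg ENNReal.ofReal (G.norm_grad_sq f p)
  rw [ENNReal.ofReal_pow (norm_nonneg _), ofReal_norm, mul_div_right_comm, mul_comm,
    ENNReal.ofReal_mul (by positivity), ENNReal.ofReal_pow (norm_nonneg _), ofReal_norm,
    ENNReal.ofReal_div_of_pos two_pos, ENNReal.ofReal_coe_nnreal, ENNReal.div_eq_inv_mul] at h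
  rw [h]
  simp only [ENNReal.ofReal_ofNat]
  ring

theorem energy_eq_tsum_grad (f : X → ℂ) : G.energy f = ∑' p, ‖G.grad f p‖ₑ ^ 2 := by
  simp only [enorm_grad_sq, ENNReal.tsum_mul_left, energy]

/-- The Hilbert space containing the discrete gradients of the functions of finite energy. -/
noncomputable abbrev EdgeSpace (X : Type*) := lp (fun _ : X × X => ℂ) 2

theorem memℓp_grad {f : X → ℂ} (hf : G.energy f < ∞) : Memℓp (G.grad f) 2 := by
  refine memℓp_gen ?_
  have h := (G.summable_of_energy_lt_top hf).div_const 2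
  simpa [norm_grad_sq] using h

theorem energy_eq_enorm_sq {f : X → ℂ} {w : EdgeSpace X} (h : ∀ p, w p = G.grad f p) :
    G.energy f = ‖w‖ₑ ^ 2 := by
  have h1 : ‖w‖ ^ 2 = ∑' p, ‖w p‖ ^ 2 := by
    have := lp.norm_rpow_eq_tsum (p := 2) (by norm_num) w
    simpa using this
  have h2 : Summable fun p => ‖w p‖ ^ 2 := by
    have := (lp.memℓp w).summable (by norm_num)
    simpa using this
  rw [energy_eq_tsum_grad, ← ofReal_norm, ← ENNReal.ofReal_pow (norm_nonneg _), h1,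
    ENNReal.ofReal_tsum_of_nonneg (fun _ => by positivity) h2]
  refine tsum_congr fun p => ?_
  rw [ENNReal.ofReal_pow (norm_nonneg _), ofReal_norm, h]

theorem energyForm_eq_inner {f g : X → ℂ} {v w : EdgeSpace X} (hv : ∀ p, v p = G.grad f p)
    (hw : ∀ p, w p = G.grad g p) : G.energyForm f g = ⟪v, w⟫_ℂ := by
  rw [lp.inner_eq_tsum, energyForm, ← tsum_mul_left]
  refine tsum_congr fun p => ?_
  rw [hv, hw, RCLike.inner_apply', grad, grad, map_mul, Complex.conj_ofReal]
  have h : ((√(G.b p.1 p.2 / 2) : ℝ) : ℂ) * (√(G.b p.1 p.2 / 2) : ℝ) = (G.b p.1 p.2 : ℝ) / 2 := by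
    rw [← Complex.ofReal_mul, Real.mul_self_sqrt (by positivity)]
    simp
  linear_combination (conj (f p.1 - f p.2) * (g p.1 - g p.2)) * (-h)

/-- A bound of the energy by the `ℓ²` norm weighted with the degree. -/
theorem energy_le_tsum_deg (f : X → ℂ) : G.energy f ≤ 2 * ∑' x, (G.deg x : ℝ≥0∞) * ‖f x‖ₑ ^ 2 := by
  have hdeg : ∀ x, (G.deg x : ℝ≥0∞) = ∑' y, (G.b x y : ℝ≥0∞) := fun x =>
    ENNReal.coe_tsum (G.summable x)
  have h : ∀ p : X × X, (G.b p.1 p.2 : ℝ≥0∞) * ‖f p.1 - f p.2‖ₑ ^ 2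
      ≤ 2 * ((G.b p.1 p.2 : ℝ≥0∞) * ‖f p.1‖ₑ ^ 2 + (G.b p.1 p.2 : ℝ≥0∞) * ‖f p.2‖ₑ ^ 2) := by
    intro p
    have h1 := enorm_add_sq_le (f p.1) (-f p.2)
    rw [enorm_neg, ← sub_eq_add_neg] at h1
    calc _ ≤ (G.b p.1 p.2 : ℝ≥0∞) * (2 * (‖f p.1‖ₑ ^ 2 + ‖f p.2‖ₑ ^ 2)) := by gcongr
      _ = _ := by ring
  have h1 : ∑' p : X × X, (G.b p.1 p.2 : ℝ≥0∞) * ‖f p.1‖ₑ ^ 2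
      = ∑' x, (G.deg x : ℝ≥0∞) * ‖f x‖ₑ ^ 2 := by
    rw [ENNReal.tsum_prod' (f := fun p : X × X => (G.b p.1 p.2 : ℝ≥0∞) * ‖f p.1‖ₑ ^ 2)]
    simp only [ENNReal.tsum_mul_right, hdeg]
  have h2 : ∑' p : X × X, (G.b p.1 p.2 : ℝ≥0∞) * ‖f p.2‖ₑ ^ 2
      = ∑' x, (G.deg x : ℝ≥0∞) * ‖f x‖ₑ ^ 2 := by
    rw [← h1, ← (Equiv.prodComm X X).tsum_eq]
    refine tsum_congr fun p => ?_
    simp [G.symm p.1 p.2]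
  calc G.energy f ≤ 2⁻¹ * ∑' p : X × X, 2 * ((G.b p.1 p.2 : ℝ≥0∞) * ‖f p.1‖ₑ ^ 2
        + (G.b p.1 p.2 : ℝ≥0∞) * ‖f p.2‖ₑ ^ 2) := by
          unfold energy
          exact mul_le_mul_right (ENNReal.tsum_le_tsum h) _
    _ = 2 * ∑' x, (G.deg x : ℝ≥0∞) * ‖f x‖ₑ ^ 2 := by
      rw [ENNReal.tsum_mul_left, ENNReal.tsum_add, h1, h2, ← mul_assoc,
        ENNReal.inv_mul_cancel (by simp) (by simp), one_mul, two_mul]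

variable [MeasurableSpace X] (m : Measure X) (hm : ∀ x, 0 < m {x})

/-- The finitely supported functions, paired with their gradients. -/
noncomputable def formCore : Submodule ℂ (WithLp 2 (Lp ℂ 2 m × EdgeSpace X)) where
  carrier := {u | (Function.support u.fst).Finite ∧ ∀ p, u.snd p = G.grad u.fst p}
  zero_mem' := by
    have h0 := Lp.coeFn_zero_eq hm
    constructor
    · rw [WithLp.zero_fst, h0]
      simp
    · rw [WithLp.zero_fst, h0]
      simp [grad]
  add_mem' := by
    rintro u v ⟨h1, h2⟩ ⟨h3, h4⟩
    refine ⟨?_, fun p => ?_⟩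
    · rw [WithLp.add_fst, Lp.coeFn_add_eq hm]
      exact (h1.union h3).subset (Function.support_add _ _)
    · rw [WithLp.add_fst, WithLp.add_snd, Lp.coeFn_add_eq hm, lp.coeFn_add, Pi.add_apply, h2, h4]
      simp only [grad, Pi.add_apply]
      ring
  smul_mem' := by
    rintro c u ⟨h1, h2⟩
    refine ⟨?_, fun p => ?_⟩
    · rw [WithLp.smul_fst, Lp.coeFn_smul_eq hm]
      exact h1.subset (Function.support_const_smul_subset _ _)
    · rw [WithLp.smul_fst, WithLp.smul_snd, Lp.coeFn_smul_eq hm, lp.coeFn_smul, Pi.smul_apply, h2]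
      simp only [grad, Pi.smul_apply, smul_eq_mul]
      ring

/-- The form domain, realized as the Hilbert space of the pairs `(f, grad f)`. -/
noncomputable def formSpace : Submodule ℂ (WithLp 2 (Lp ℂ 2 m × EdgeSpace X)) :=
  (G.formCore m hm).topologicalClosure

instance : CompleteSpace (G.formSpace m hm) :=
  (G.formCore m hm).isClosed_topologicalClosure.completeSpace_coe

variable {m hm}

/-- The squared distance between `(f, grad f)` and `(g, grad g)` is the energy of `f - g` plus `‖f -
g‖ ^ 2`, so approximation in the form norm is approximation by elements of `formCore`. -/
theorem exists_mem_formSpace {f : Lp ℂ 2 m} (hf : f ∈ G.dirichletFormDomain m hm) :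
    ∃ u ∈ G.formSpace m hm, u.fst = f := by
  refine ⟨WithLp.toLp 2 (f, ⟨G.grad f, G.memℓp_grad hf.1⟩), ?_, rfl⟩
  refine EMetric.mem_closure_iff.2 fun ε hε => ?_
  obtain ⟨g, hg, hgε⟩ := hf.2 (ε ^ 2) (by positivity)
  have hsub : G.energy (f - g : Lp ℂ 2 m) < ∞ := (le_self_add.trans_lt hgε).trans_le le_top
  -- Needed for `grad g` to lie in `EdgeSpace`; it follows from `g = f - (f - g)`.
  have hgE : G.energy g < ∞ := by
    have h : (g : X → ℂ) = f + (-1 : ℂ) • ((f - g : Lp ℂ 2 m) : X → ℂ) := by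
      rw [Lp.coeFn_sub_eq hm]
      simp
    rw [h]
    refine (G.energy_add_le _ _).trans_lt (ENNReal.mul_lt_top (by simp)
      (ENNReal.add_lt_top.2 ⟨hf.1, ?_⟩))
    rw [energy_smul]
    exact ENNReal.mul_lt_top (by simp) hsub
  refine ⟨WithLp.toLp 2 (g, ⟨G.grad g, G.memℓp_grad hgE⟩), ⟨hg, fun p => rfl⟩, ?_⟩
  rw [edist_eq_enorm_sub]
  refine (ENNReal.pow_lt_pow_left_iff two_ne_zero).1 ?_
  rw [WithLp.prod_enorm_sq_eq_add, ← G.energy_eq_enorm_sq (f := (f - g : Lp ℂ 2 m))]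
  · exact hgε
  · intro p
    rw [Lp.coeFn_sub_eq hm, grad_sub]
    rfl

variable [DiscreteMeasurableSpace X] [IsFiniteMeasure m]

/-- Closability of the form: both sides are continuous in `u` for each fixed edge, so the identity
survives the closure of `formCore`. -/
theorem snd_apply_of_mem_formSpace {u : WithLp 2 (Lp ℂ 2 m × EdgeSpace X)}
    (hu : u ∈ G.formSpace m hm) (p : X × X) : u.snd p = G.grad u.fst p := by
  have hfst : ∀ x, Continuous fun u : WithLp 2 (Lp ℂ 2 m × EdgeSpace X) => u.fst x := fun x =>
    (continuous_Lp_apply hm x).comp (WithLp.fstL 2 ℂ (Lp ℂ 2 m) (EdgeSpace X)).continuous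
  have hsnd : Continuous fun u : WithLp 2 (Lp ℂ 2 m × EdgeSpace X) => u.snd p :=
    (lp.evalCLM ℂ (fun _ : X × X => ℂ) 2 p).continuous.comp
      (WithLp.sndL 2 ℂ (Lp ℂ 2 m) (EdgeSpace X)).continuous
  refine closure_minimal (s := (G.formCore m hm : Set (WithLp 2 (Lp ℂ 2 m × EdgeSpace X))))
    (t := {u : WithLp 2 (Lp ℂ 2 m × EdgeSpace X) | u.snd p = G.grad u.fst p})
    (fun v hv => hv.2 p) (isClosed_eq hsnd ?_) hu
  exact continuous_const.mul ((hfst _).sub (hfst _))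

theorem fst_mem_dirichletFormDomain {u : WithLp 2 (Lp ℂ 2 m × EdgeSpace X)}
    (hu : u ∈ G.formSpace m hm) : u.fst ∈ G.dirichletFormDomain m hm := by
  refine ⟨?_, fun ε hε => ?_⟩
  · rw [G.energy_eq_enorm_sq (G.snd_apply_of_mem_formSpace hu)]
    exact ENNReal.pow_lt_top enorm_lt_top
  · have hopen : IsOpen {v : WithLp 2 (Lp ℂ 2 m × EdgeSpace X) | ‖u - v‖ₑ ^ 2 < ε} :=
      isOpen_lt (by fun_prop) continuous_const
    obtain ⟨v, hv, hvc⟩ := mem_closure_iff.1 hu _ hopen (by simpa using hε)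
    refine ⟨v.fst, hvc.1, ?_⟩
    have h1 : ∀ p, (u - v).snd p = G.grad (u.fst - v.fst : Lp ℂ 2 m) p := fun p => by
      rw [Lp.coeFn_sub_eq hm, grad_sub, WithLp.sub_snd, lp.coeFn_sub, Pi.sub_apply, Pi.sub_apply,
        G.snd_apply_of_mem_formSpace hu, hvc.2]
    rw [G.energy_eq_enorm_sq h1, ← WithLp.sub_fst, ← WithLp.prod_enorm_sq_eq_add]
    exact hv

theorem pointLp_mem_dirichletFormDomain (x : X) : pointLp m x ∈ G.dirichletFormDomain m hm :=
  G.indicator_mem_dirichletFormDomain m hm x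

/-- Evaluation at `o` is bounded on `ℓ²` because `m {o} > 0`, so the form norm controls the norm
defining `D̃₀`. This makes uniform transience applicable to the form domain. -/
theorem dirichletFormDomain_subset_energyClosure [Countable X] {f : Lp ℂ 2 m}
    (hf : f ∈ G.dirichletFormDomain m hm) (o : X) : (f : X → ℂ) ∈ G.energyClosure o := by
  refine ⟨hf.1, fun ε hε => ?_⟩
  set c : ℝ≥0∞ := 1 + (m {o})⁻¹ with hc
  have hctop : c ≠ ∞ := ENNReal.add_ne_top.2 ⟨ENNReal.one_ne_top, ENNReal.inv_ne_top.2 (hm o).ne'⟩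
  have hc0 : c ≠ 0 := by simp [hc]
  obtain ⟨g, hg, hgε⟩ := hf.2 (ε / c) (ENNReal.div_pos hε.ne' hctop)
  refine ⟨g, hg, ?_⟩
  rw [← Pi.sub_apply, ← Lp.coeFn_sub_eq hm]
  set h := f - g
  have h1 : ‖h o‖ₑ ^ 2 ≤ (m {o})⁻¹ * ‖h‖ₑ ^ 2 := by
    rw [← ENNReal.mul_le_iff_le_inv (hm o).ne' (measure_ne_top m _), mul_comm]
    exact Lp.enorm_apply_sq_mul_le h o
  calc G.energy h + ‖h o‖ₑ ^ 2 ≤ c * G.energy h + c * ‖h‖ₑ ^ 2 := by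
        refine add_le_add (le_mul_of_one_le_left zero_le le_self_add) (h1.trans ?_)
        gcongr
        exact le_add_self
    _ = c * (G.energy h + ‖h‖ₑ ^ 2) := by ring
    _ < ε := by
        rw [mul_comm]
        exact (ENNReal.lt_div_iff_mul_lt (Or.inl hc0) (Or.inl hctop)).1 hgε

end WeightedGraph

/-! ### Compact embedding and discreteness of the spectrum -/

namespace WeightedGraph

variable {X : Type*} (G : WeightedGraph X) [MeasurableSpace X]

section FormSpace

variable (m : Measure X) (hm : ∀ x, 0 < m {x})

/-- The embedding of the form domain into `ℓ²(X, m)`. -/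
noncomputable def formEmbedding : G.formSpace m hm →L[ℂ] Lp ℂ 2 m :=
  (WithLp.fstL 2 ℂ (Lp ℂ 2 m) (EdgeSpace X)).comp (G.formSpace m hm).subtypeL

/-- The gradient on the form domain. -/
noncomputable def formGrad : G.formSpace m hm →L[ℂ] EdgeSpace X :=
  (WithLp.sndL 2 ℂ (Lp ℂ 2 m) (EdgeSpace X)).comp (G.formSpace m hm).subtypeL

variable {m hm}

/-- The energy inner product is the form-space one minus that of `ℓ²`; hence the shift by one in the
eigenvalues below. -/
theorem inner_formSpace (u v : G.formSpace m hm) :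
    ⟪u, v⟫_ℂ = ⟪G.formEmbedding m hm u, G.formEmbedding m hm v⟫_ℂ
      + ⟪G.formGrad m hm u, G.formGrad m hm v⟫_ℂ :=
  WithLp.prod_inner_apply _ _

theorem exists_formEmbedding_eq {f : Lp ℂ 2 m} (hf : f ∈ G.dirichletFormDomain m hm) :
    ∃ u, G.formEmbedding m hm u = f := by
  obtain ⟨u, hu, hfu⟩ := G.exists_mem_formSpace hf
  exact ⟨⟨u, hu⟩, hfu⟩

variable [DiscreteMeasurableSpace X] [IsFiniteMeasure m]

theorem energyForm_formEmbedding (u v : G.formSpace m hm) :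
    G.energyForm (G.formEmbedding m hm u) (G.formEmbedding m hm v)
      = ⟪G.formGrad m hm u, G.formGrad m hm v⟫_ℂ :=
  G.energyForm_eq_inner (G.snd_apply_of_mem_formSpace u.2) (G.snd_apply_of_mem_formSpace v.2)

theorem energy_formEmbedding (u : G.formSpace m hm) :
    G.energy (G.formEmbedding m hm u) = ‖G.formGrad m hm u‖ₑ ^ 2 :=
  G.energy_eq_enorm_sq (G.snd_apply_of_mem_formSpace u.2)

theorem formEmbedding_mem (u : G.formSpace m hm) :
    G.formEmbedding m hm u ∈ G.dirichletFormDomain m hm :=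
  G.fst_mem_dirichletFormDomain u.2

variable {G}

/-- Uniform transience bounds the functions in the form domain uniformly. -/
theorem IsUniformlyTransient.exists_enorm_apply_sq_le [Countable X] (hG : G.IsUniformlyTransient) :
    ∃ C : ℝ≥0, ∀ (u : G.formSpace m hm) (x : X),
      ‖G.formEmbedding m hm u x‖ₑ ^ 2 ≤ C * ‖u‖ₑ ^ 2 := by
  obtain ⟨-, C, -, hC⟩ := hG
  refine ⟨C, fun u x => ?_⟩
  have h := hC x _ (G.dirichletFormDomain_subset_energyClosure (G.formEmbedding_mem u) x)
  calc ‖G.formEmbedding m hm u x‖ₑ ^ 2 ≤ (⨆ y, ‖G.formEmbedding m hm u y‖ₑ) ^ 2 := by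
        gcongr
        exact le_iSup (fun y => ‖G.formEmbedding m hm u y‖ₑ) x
    _ ≤ C * G.energy (G.formEmbedding m hm u) := h
    _ ≤ C * ‖u‖ₑ ^ 2 := by
        rw [energy_formEmbedding]
        refine mul_le_mul_right ?_ _
        exact le_self_add.trans_eq
          (WithLp.prod_enorm_sq_eq_add (u : WithLp 2 (Lp ℂ 2 m × EdgeSpace X))).symm

/-- For a uniformly transient graph and a finite measure, the form domain embeds compactly into
`ℓ²(X, m)`. -/
theorem IsUniformlyTransient.isCompactOperator_formEmbedding [Countable X]
    (hG : G.IsUniformlyTransient) : IsCompactOperator (G.formEmbedding m hm) := by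
  classical
  obtain ⟨C, hC⟩ := hG.exists_enorm_apply_sq_le (m := m) (hm := hm)
  obtain ⟨e, he⟩ := exists_injective_nat X
  let s : ℕ → Finset X := fun n =>
    ((Set.finite_Iio n).preimage he.injOn).toFinset
  have hmem : ∀ n x, x ∈ s n ↔ e x < n := fun n x => by simp [s]
  have htail : Tendsto (fun n => m (s n : Set X)ᶜ) atTop (𝓝 0) := by
    have h := tendsto_measure_iInter_atTop (μ := m) (s := fun n => (s n : Set X)ᶜ)
      (fun n => (Set.to_countable _).measurableSet.nullMeasurableSet) (fun a b hab => by
        intro x hx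
        simp only [Set.mem_compl_iff, Finset.mem_coe, hmem] at hx ⊢
        omega) ⟨0, measure_ne_top m _⟩
    have h0 : ⋂ n, (s n : Set X)ᶜ = ∅ := by
      refine Set.eq_empty_of_forall_notMem fun x hx => ?_
      have := Set.mem_iInter.1 hx (e x + 1)
      simp [hmem] at this
    rwa [h0, measure_empty] at h
  -- The cut-offs converge in operator norm: the error at stage `n` is governed by the mass outside
  -- `s n`.
  have hbound : ∀ n, ‖(finsetProj m (s n)).comp (G.formEmbedding m hm) - G.formEmbedding m hm‖
      ≤ √(C * m.real (s n : Set X)ᶜ) := by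
    intro n
    refine ContinuousLinearMap.opNorm_le_bound _ (Real.sqrt_nonneg _) fun u => ?_
    rw [← Real.sqrt_sq (norm_nonneg u), ← Real.sqrt_mul (by positivity)]
    refine Real.le_sqrt_of_sq_le ?_
    have h := enorm_sub_finsetProj_sq_le hm (s n) _ (hC u)
    have h1 := ENNReal.toReal_mono (by finiteness) h
    simp only [ENNReal.toReal_pow, ENNReal.toReal_mul, toReal_enorm, ENNReal.coe_toReal] at h1
    rw [_root_.sub_apply, ContinuousLinearMap.comp_apply, norm_sub_rev]
    refine h1.trans (le_of_eq ?_)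
    rw [measureReal_def]
    ring
  refine isCompactOperator_of_tendsto
    (F := fun n => (finsetProj m (s n)).comp (G.formEmbedding m hm)) (l := atTop) ?_
    (Eventually.of_forall fun n =>
      (isCompactOperator_finsetProj (s n)).comp_clm (G.formEmbedding m hm))
  refine (tendsto_iff_norm_sub_tendsto_zero (E := G.formSpace m hm →L[ℂ] Lp ℂ 2 m)).2 ?_
  refine squeeze_zero (fun n => norm_nonneg
    ((finsetProj m (s n)).comp (G.formEmbedding m hm) - G.formEmbedding m hm)) hbound ?_
  have h1 : Tendsto (fun n => m.real (s n : Set X)ᶜ) atTop (𝓝 0) := by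
    exact (ENNReal.tendsto_toReal ENNReal.zero_ne_top).comp htail
  have h2 := (h1.const_mul (C : ℝ)).sqrt
  simpa using h2

variable (G)

/-- Turns the weak eigenvalue equation into one between inner products on `formSpace`, where the
abstract Hilbert space results apply. -/
theorem mem_dirichletLaplacianGraph_iff (f g : Lp ℂ 2 m) :
    (f, g) ∈ G.dirichletLaplacianGraph m hm ↔ ∃ u, G.formEmbedding m hm u = f ∧
      ∀ v, ⟪G.formGrad m hm v, G.formGrad m hm u⟫_ℂ = ⟪G.formEmbedding m hm v, g⟫_ℂ := by
  constructor
  · rintro ⟨hf, h⟩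
    obtain ⟨u, rfl⟩ := G.exists_formEmbedding_eq hf
    refine ⟨u, rfl, fun v => ?_⟩
    rw [← energyForm_formEmbedding]
    exact h _ (G.formEmbedding_mem v)
  · rintro ⟨u, rfl, h⟩
    refine ⟨G.formEmbedding_mem u, fun f hf => ?_⟩
    obtain ⟨v, rfl⟩ := G.exists_formEmbedding_eq hf
    rw [← h, ← energyForm_formEmbedding]

variable {G}

/-- For a uniformly transient graph and a finite measure, the Dirichlet Laplacian has purely
discrete spectrum. -/
theorem IsUniformlyTransient.exists_isEigenvalueSequence [Countable X] [Infinite X]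
    (hG : G.IsUniformlyTransient) :
    ∃ ev, IsEigenvalueSequence (G.dirichletLaplacian m hm) ev := by
  -- The form domain contains the point indicators, and these separate the elements of `ℓ²`.
  have hdense : ∀ f, (∀ u, ⟪G.formEmbedding m hm u, f⟫_ℂ = 0) → f = 0 := fun f hf => by
    refine Lp.ext_apply fun x => ?_
    obtain ⟨u, hu⟩ := G.exists_formEmbedding_eq (hm := hm) (G.pointLp_mem_dirichletFormDomain x)
    have h1 := hf u
    rw [hu, inner_pointLp] at h1
    have h2 : (m.real {x} : ℂ) ≠ 0 := by exact_mod_cast (real_singleton_pos hm x).ne'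
    rw [(mul_eq_zero.1 h1).resolve_left h2, Lp.coeFn_zero_eq hm, Pi.zero_apply]
  obtain ⟨ν, φ, u, hmono, hlim, hu, huv⟩ :=
    hG.isCompactOperator_formEmbedding.exists_hilbertBasis_of_embedding hdense
      (not_finiteDimensional_Lp hm)
  refine ⟨fun k => ν k - 1, fun a b hab => sub_le_sub_right (hmono hab) 1,
    tendsto_atTop_add_const_right _ _ hlim, φ, fun k => ?_⟩
  have hmem : (φ k, ((ν k - 1 : ℝ) : ℂ) • φ k) ∈ G.dirichletLaplacianGraph m hm := by
    refine (G.mem_dirichletLaplacianGraph_iff _ _).2 ⟨u k, hu k, fun v => ?_⟩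
    have h1 := G.inner_formSpace v (u k)
    rw [huv, hu] at h1
    rw [inner_smul_right]
    push_cast
    linear_combination -h1
  rw [← dirichletLaplacian_graph] at hmem
  obtain ⟨y, hy1, hy2⟩ := (LinearPMap.mem_graph_iff _).1 hmem
  simp only at hy1 hy2
  refine ⟨hy1 ▸ y.2, ?_⟩
  rw [← hy2]
  congr 1
  exact Subtype.ext hy1.symm

end FormSpace

/-! ### Min-max upper bound for the eigenvalues -/

section UpperBound

variable [DiscreteMeasurableSpace X] [Countable X] {m : Measure X} [IsFiniteMeasure m]
  {hm : ∀ x, 0 < m {x}} {G}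

/-- Eigenvalue bound from the test space of the functions supported on the first `k + 1` vertices
of an enumeration. -/
theorem eigenvalue_le {ev : ℕ → ℝ} (hev : IsEigenvalueSequence (G.dirichletLaplacian m hm) ev)
    {e : ℕ → X} (he : Function.Injective e) {k : ℕ} {M : ℝ≥0}
    (hM : ∀ j ≤ k, (G.deg (e j) : ℝ≥0∞) ≤ M * m {e j}) : ev k ≤ 2 * M := by
  obtain ⟨hmono, -, φ, hφ⟩ := hev
  have hgraph : ∀ i, ∃ u, G.formEmbedding m hm u = φ i ∧ ∀ v,
      ⟪G.formGrad m hm v, G.formGrad m hm u⟫_ℂ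
        = ⟪G.formEmbedding m hm v, (ev i : ℂ) • φ i⟫_ℂ := fun i => by
    obtain ⟨hi, hLi⟩ := hφ i
    rw [← mem_dirichletLaplacianGraph_iff, ← dirichletLaplacian_graph, ← hLi]
    exact (G.dirichletLaplacian m hm).mem_graph ⟨φ i, hi⟩
  choose w hw1 hw2 using hgraph
  let T : (Fin (k + 1) → ℂ) →ₗ[ℂ] Lp ℂ 2 m :=
    Fintype.linearCombination ℂ fun j : Fin (k + 1) => pointLp m (e j)
  let F : (Fin (k + 1) → ℂ) →ₗ[ℂ] (Fin k → ℂ) :=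
    (LinearMap.pi fun i : Fin k => (innerSL ℂ (φ i) : Lp ℂ 2 m →L[ℂ] ℂ).toLinearMap) ∘ₗ T
  -- There are `k + 1` coefficients and only `k` orthogonality conditions.
  obtain ⟨c, hc, hc0⟩ := (Submodule.ne_bot_iff _).1
    (LinearMap.ker_ne_bot_of_finrank_lt (f := F) (by simp))
  have hTinj : Function.Injective T := by
    have h := (linearIndependent_pointLp hm).comp (fun j : Fin (k + 1) => e j)
      (he.comp Fin.val_injective)
    exact linearIndependent_iff_injective_fintypeLinearCombination.1 h
  have hT0 : T c ≠ 0 := fun h => hc0 (hTinj (by rw [h, map_zero]))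
  have hTsum : T c = ∑ j : Fin (k + 1), c j • pointLp m (e j) :=
    Fintype.linearCombination_apply ..
  have hTdom : T c ∈ G.dirichletFormDomain m hm := by
    rw [hTsum]
    exact Submodule.sum_mem _ fun j _ =>
      Submodule.smul_mem _ _ (G.pointLp_mem_dirichletFormDomain _)
  obtain ⟨u, hu⟩ := G.exists_formEmbedding_eq hTdom
  have hlow : ev k * ‖T c‖ ^ 2 ≤ ‖G.formGrad m hm u‖ ^ 2 := by
    rw [← hu]
    refine φ.eigenvalue_mul_norm_sq_le (G.formEmbedding m hm).toLinearMap
      (G.formGrad m hm).toLinearMap hmono hw1 (fun v i => ?_) fun i hi => ?_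
    · rw [ContinuousLinearMap.coe_coe, ContinuousLinearMap.coe_coe, hw2, inner_smul_right]
    · have h := congrFun (LinearMap.mem_ker.1 hc) ⟨i, hi⟩
      rw [ContinuousLinearMap.coe_coe, hu]
      exact h
  -- The hypothesis `hM` compares degree and mass only on the first `k + 1` vertices; `T c` vanishes
  -- elsewhere.
  have hupp : ‖G.formGrad m hm u‖ₑ ^ 2 ≤ 2 * M * ‖T c‖ₑ ^ 2 := by
    rw [← energy_formEmbedding, hu, Lp.enorm_sq_eq_tsum, mul_assoc, ← ENNReal.tsum_mul_left]
    refine (G.energy_le_tsum_deg _).trans ?_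
    gcongr 2 * ?_
    refine ENNReal.tsum_le_tsum fun x => ?_
    by_cases hx : ∃ j ≤ k, e j = x
    · obtain ⟨j, hj, rfl⟩ := hx
      calc _ ≤ M * m {e j} * ‖T c (e j)‖ₑ ^ 2 := by gcongr; exact hM j hj
        _ = _ := by ring
    · have h : T c x = 0 := by
        rw [hTsum, Lp.coeFn_sum_eq hm]
        refine Finset.sum_eq_zero fun j _ => ?_
        have hne : x ≠ e j := fun h => hx ⟨j, Nat.lt_succ_iff.1 j.2, h.symm⟩
        simp [Lp.coeFn_smul_eq hm, coe_pointLp hm, hne]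
      simp [h]
  have hupp' := ENNReal.toReal_mono (by finiteness) hupp
  simp only [ENNReal.toReal_pow, ENNReal.toReal_mul, toReal_enorm, ENNReal.coe_toReal,
    ENNReal.toReal_ofNat] at hupp'
  exact le_of_mul_le_mul_right (hlow.trans hupp') (pow_pos (norm_pos_iff.2 hT0) 2)

end UpperBound

end WeightedGraph

/-! ### Choice of the measure -/

/-- Every summable positive sequence is the sequence of point masses of a finite measure. -/
theorem exists_finite_measure_singleton {X : Type*} [MeasurableSpace X]
    [MeasurableSingletonClass X] (e : ℕ ≃ X) {ρ : ℕ → ℝ} (hρ : ∀ n, 0 < ρ n) (hs : Summable ρ) :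
    ∃ m : Measure X, IsFiniteMeasure m ∧ ∀ n, m {e n} = ENNReal.ofReal (ρ n) := by
  refine ⟨Measure.sum fun n => ENNReal.ofReal (ρ n) • Measure.dirac (e n), ⟨?_⟩, fun n => ?_⟩
  · rw [Measure.sum_apply _ MeasurableSet.univ]
    simp only [Measure.smul_apply, measure_univ, smul_eq_mul, mul_one]
    rw [← ENNReal.ofReal_tsum_of_nonneg (fun n => (hρ n).le) hs]
    exact ENNReal.ofReal_lt_top
  · rw [Measure.sum_apply _ (measurableSet_singleton _), tsum_eq_single n]
    · simp
    · intro j hj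
      simp [e.injective.ne hj]

theorem mainTheorem5 {X : Type*} [Countable X] [Infinite X] [MeasurableSpace X]
    [DiscreteMeasurableSpace X] (G : WeightedGraph X) (hG : G.IsUniformlyTransient)
    (hdeg : BddAbove (Set.range G.deg)) (ε : ℝ) (hε : 0 < ε) :
    ∃ (m : Measure X) (_ : IsFiniteMeasure m) (hm : ∀ x, 0 < m {x}),
      (∃ ev : ℕ → ℝ, IsEigenvalueSequence (G.dirichletLaplacian m hm) ev) ∧
      ∀ ev : ℕ → ℝ, IsEigenvalueSequence (G.dirichletLaplacian m hm) ev →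
        Tendsto (fun k : ℕ => ev k / ((k : ℝ) + 1) ^ (1 + ε)) atTop (𝓝 0) := by
  obtain ⟨_⟩ := nonempty_denumerable X
  let e : ℕ ≃ X := (Denumerable.eqv X).symm
  obtain ⟨K, hK⟩ := hdeg
  have hK : ∀ x, G.deg x ≤ K := fun x => hK ⟨x, rfl⟩
  -- The exponent `1 + ε / 2` exceeds 1, making the masses summable, and stays below `1 + ε`,
  -- leaving room for decay.
  have hpow : ∀ n : ℕ, 0 < ((n : ℝ) + 1) ^ (1 + ε / 2) := fun n => by positivity
  have hsum : Summable fun n : ℕ => (((n : ℝ) + 1) ^ (1 + ε / 2))⁻¹ := by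
    refine ((Real.summable_one_div_nat_add_rpow 1 (1 + ε / 2)).2 (by linarith)).congr fun n => ?_
    rw [abs_of_pos (by positivity), one_div]
  obtain ⟨m, hfin, hme⟩ := exists_finite_measure_singleton e (fun n => inv_pos.2 (hpow n)) hsum
  have hm : ∀ x, 0 < m {x} := fun x => by
    rw [← e.apply_symm_apply x, hme]
    exact ENNReal.ofReal_pos.2 (inv_pos.2 (hpow _))
  refine ⟨m, hfin, hm, hG.exists_isEigenvalueSequence, fun ev hev => ?_⟩
  have hle : ∀ k : ℕ, ev k ≤ 2 * K * ((k : ℝ) + 1) ^ (1 + ε / 2) := fun k => by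
    -- The masses decrease along the enumeration, so the mass of `e k` is the smallest among `j ≤ k`
    -- and determines `M`.
    have h := WeightedGraph.eigenvalue_le hev e.injective (k := k)
      (M := K * (((k : ℝ) + 1) ^ (1 + ε / 2)).toNNReal) fun j hj => by
        rw [hme, ENNReal.coe_mul, mul_assoc, ← ENNReal.ofReal, ← ENNReal.ofReal_mul (hpow k).le]
        calc (G.deg (e j) : ℝ≥0∞) ≤ K := by exact_mod_cast hK _
          _ ≤ _ := by
            refine le_mul_of_one_le_right zero_le (ENNReal.one_le_ofReal.2 ?_)
            rw [← div_eq_mul_inv, one_le_div (hpow j)]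
            gcongr
    rw [NNReal.coe_mul, Real.coe_toNNReal _ (hpow k).le, ← mul_assoc] at h
    exact h
  have hupper : Tendsto (fun k : ℕ => 2 * (K : ℝ) * ((k : ℝ) + 1) ^ (-(ε / 2))) atTop (𝓝 0) := by
    have h1 : Tendsto (fun k : ℕ => (k : ℝ) + 1) atTop atTop :=
      tendsto_atTop_add_const_right _ _ tendsto_natCast_atTop_atTop
    have h2 := ((tendsto_rpow_neg_atTop (half_pos hε)).comp h1).const_mul (2 * (K : ℝ))
    simpa using h2
  -- The lower bound zero is needed only eventually, where it follows from `ev` tending to infinity.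
  -- Indices start at 0, so `ev k` is the eigenvalue numbered `k + 1`.
  refine squeeze_zero' ?_ (Eventually.of_forall fun k => ?_) hupper
  · filter_upwards [hev.2.1.eventually_ge_atTop 0] with k hk
    positivity
  · rw [div_le_iff₀ (by positivity), mul_assoc, ← Real.rpow_add (by positivity)]
    refine (hle k).trans (le_of_eq ?_)
    congr 2
    ring
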